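/- Let $(V,\circ,\langle\cdot,\cdot\rangle)$ be a Euclidean Jordan algebra, i.e. a finite-dimensional real inner product space with a commutative bilinear product $\circ$ that has a unit element and satisfies $x\circ(x^2\circ y)=x^2\circ(x\circ y)$ and $\langle x\circ y,z\rangle=\langle y,x\circ z\rangle$ for all $x,y,z\in V$, where $x^2:=x\circ x$. Let $V_+:=\{x^2: x\in V\}$ be its symmetric cone. For $x\in V$ let $x^+$ denote the (metric) projection of $x$ onto $V_+$, for $a\in V_+$ let $\sqrt a$ denote the unique element of $V_+$ whose square is $a$, and for $x,y\in V$ put $x\sqcap y:=x-(x-y)^+$. Then for all $x,y\in V$ and all real $t$ with $0\le t\le 1$, $$t\left[x+y-\sqrt{x^2+y^2}\right]+(1-t)\,(x\sqcap y)=0\iff x\sqcap y=0.$$ -/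

import Mathlib

/-- A Euclidean Jordan algebra: a finite-dimensional real inner product space `V` with a unital,
commutative, bilinear product satisfying the Jordan identity `x ∘ (x² ∘ y) = x² ∘ (x ∘ y)`
(this is `IsCommJordan`) for which the inner product is associative:
`⟪x ∘ y, z⟫ = ⟪y, x ∘ z⟫`. The Jordan product is written `x * y`; it is in general not associative.
Additivity and homogeneity in the second argument follow by commutativity. -/
class EuclideanJordanAlgebra (V : Type*) [NormedAddCommGroup V] [InnerProductSpace ℝ V]
    [FiniteDimensional ℝ V] extends CommMagma V, IsCommJordan V, One V where
  add_mul' : ∀ x y z : V, (x + y) * z = x * z + y * z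
  smul_mul' : ∀ (r : ℝ) (x y : V), (r • x) * y = r • (x * y)
  one_mul' : ∀ x : V, 1 * x = x
  inner_mul' : ∀ x y z : V, inner ℝ (x * y) z = inner ℝ y (x * z)

namespace EuclideanJordanAlgebra

noncomputable section

variable {V : Type*} [NormedAddCommGroup V] [InnerProductSpace ℝ V] [FiniteDimensional ℝ V]
  [EuclideanJordanAlgebra V]

variable (V) in
/-- The (closed) symmetric cone `V₊` of `V`: the set of all squares. -/
def symmetricCone : Set V := {a | ∃ x : V, a = x * x}

/-- `p` is a metric projection of `x` onto `V₊`: a point of `V₊` nearest to `x`. -/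
def IsConeProj (x p : V) : Prop :=
  p ∈ symmetricCone V ∧ ∀ z ∈ symmetricCone V, ‖x - p‖ ≤ ‖x - z‖

/-- `s` is a square root of `a` in the symmetric cone: `s ∈ V₊` and `s² = a`. -/
def IsConeSqrt (a s : V) : Prop :=
  s ∈ symmetricCone V ∧ s * s = a

/-- `x⁺`, the projection of `x` onto `V₊` (which exists and is unique, `V₊` being a nonempty
closed convex cone). -/
def posPart (x : V) : V := Classical.epsilon (IsConeProj x)

/-- `√a`, for `a ∈ V₊` the (unique) element of `V₊` whose square is `a`;
an unspecified value for `a ∉ V₊`. -/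
def sqrt (a : V) : V := Classical.epsilon (IsConeSqrt a)

/-- The min map `x ⊓ y = x - (x - y)⁺`. -/
def minMap (x y : V) : V := x - posPart (x - y)

/-- The Fischer–Burmeister map `x + y - √(x² + y²)`. -/
def fischerBurmeister (x y : V) : V := x + y - sqrt (x * x + y * y)

end

end EuclideanJordanAlgebra

/-!
Write `L_a` for the multiplication by `a`. It is symmetric, hence diagonalizable, and `x` is power
associative, so `f(x)` makes sense for every real function `f` on the eigenvalues of `L_x`. For an
idempotent `e` the eigenvalues of `L_e` are among `0, 1/2, 1`; since every `f(x)` with `f ≥ 0` is a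
nonnegative combination of idempotents, `V₊` is the set of all `a` with `L_a` positive. In
particular `V₊` is a convex cone whose elements have pairwise nonnegative inner products, and `x⁺`
is the functional calculus of `max(·, 0)`, so that `2x⁺ = x + √(x²)`.

Put `s = x + y`, `A = √(x² + y²)` and `B = √((x - y)²)`. Then `2 (x ⊓ y) = s - B`, the equation says
`(1 + t) s = 2t A + (1 - t) B`, and `2A² = s² + B²`. Multiplying the last identity by `(1 + t)²` and
substituting gives `(A - B) ∘ (α A + β B) = 0` with `α = 2 + 4t - 2t²` and `β = 2 + 2t²`. If
`α, β > 0`, positivity of `L_A` and `L_B` forces `(A - B)² = 0`, so `A = B = s`. The condition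
`α > 0` is `(t - 1)² < 2`; its end points `t = 1 ± √2` fail in `V = ℝ` at `x = y = ±1`.
-/

noncomputable section

open Polynomial LinearMap

section SymmetricOperator

variable {𝕜 E : Type*} [RCLike 𝕜] [NormedAddCommGroup E] [InnerProductSpace 𝕜 E]

theorem aeval_eq_aeval_of_isSymmetric [FiniteDimensional 𝕜 E] {T : Module.End 𝕜 E}
    (hT : T.IsSymmetric) {p q : 𝕜[X]} (h : ∀ μ, T.HasEigenvalue μ → p.eval μ = q.eval μ) :
    aeval T p = aeval T q := by
  refine (hT.eigenvectorBasis rfl).toBasis.ext fun i => ?_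
  have hv := hT.hasEigenvector_eigenvectorBasis rfl i
  rw [OrthonormalBasis.coe_toBasis, Module.End.aeval_apply_of_hasEigenvector hv,
    Module.End.aeval_apply_of_hasEigenvector hv,
    h _ (Module.End.hasEigenvalue_of_hasEigenvector hv)]

theorem isPositive_of_forall_eigenvalue_nonneg [FiniteDimensional 𝕜 E] {T : Module.End 𝕜 E}
    (hT : T.IsSymmetric) (h : ∀ μ : ℝ, T.HasEigenvalue (μ : 𝕜) → 0 ≤ μ) : T.IsPositive := by
  refine ⟨hT, fun v => ?_⟩
  let b := hT.eigenvectorBasis rfl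
  rw [← b.sum_inner_mul_inner, map_sum]
  refine Finset.sum_nonneg fun i _ => ?_
  rw [hT, hT.apply_eigenvectorBasis, inner_smul_right, mul_assoc, RCLike.re_ofReal_mul]
  refine mul_nonneg (h _ (hT.hasEigenvalue_eigenvalues rfl i)) ?_
  rw [inner_mul_symm_re_eq_norm]
  exact norm_nonneg _

theorem apply_eq_zero_of_isPositive {F : Type*} [NormedAddCommGroup F] [InnerProductSpace ℝ F]
    {T : F →ₗ[ℝ] F} (hT : T.IsPositive) {v : F} (hv : inner ℝ (T v) v = 0) : T v = 0 := by
  let B : LinearMap.BilinForm ℝ F := innerₗ F ∘ₗ T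
  have hB : LinearMap.IsSymm B :=
    ⟨fun x y => by simpa [B, real_inner_comm] using hT.isSymmetric x y⟩
  have hker := (B.apply_apply_same_eq_zero_iff hT.inner_nonneg_left hB).mp hv
  exact inner_self_eq_zero.mp (LinearMap.congr_fun hker (T v))

end SymmetricOperator

namespace JordanAlgebra

section PolyEval

variable {R A : Type*} [CommSemiring R] [NonAssocSemiring A] [Module R A] [SMulCommClass R A A]

variable (R) in
/-- The value `p(x)` of a polynomial `p` at an element `x` of a Jordan algebra, encoded as
`p(L_x) 1` with `L_x` the multiplication by `x`, because `Polynomial.aeval x` needs an associative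
algebra. -/
def polyEval (x : A) : R[X] →ₗ[R] A :=
  LinearMap.applyₗ 1 ∘ₗ (aeval (mulLeft R x)).toLinearMap

theorem polyEval_apply (x : A) (p : R[X]) : polyEval R x p = aeval (mulLeft R x) p 1 := rfl

theorem polyEval_X (x : A) : polyEval R x X = x := by simp [polyEval_apply]

theorem polyEval_X_pow_succ (x : A) (n : ℕ) :
    polyEval R x (X ^ (n + 1)) = x * polyEval R x (X ^ n) := by
  simp [polyEval_apply, pow_succ']

end PolyEval

section NonUnital

variable {A : Type*} [NonUnitalNonAssocCommRing A] [IsCommJordan A] [IsAddTorsionFree A]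

theorem linearized_jordan (a b c d : A) :
    (a * b) * (c * d) + (b * c) * (a * d) + (c * a) * (b * d) =
      c * ((a * b) * d) + a * ((b * c) * d) + b * ((c * a) * d) := by
  have h : 2 • (a * ((b * c) * d) - (b * c) * (a * d) + (b * ((c * a) * d) - (c * a) * (b * d)) +
      (c * ((a * b) * d) - (a * b) * (c * d))) = 0 :=
    congrArg (· d) (two_nsmul_lie_lmul_lmul_add_add_eq_zero a b c)
  rw [smul_eq_zero_iff_right two_ne_zero] at h
  rw [← sub_eq_zero, ← neg_eq_zero, ← h]
  abel

variable {R : Type*} [CommRing R] [Module R A] [SMulCommClass R A A]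

theorem mulLeft_mul_mul (a b c : A) :
    mulLeft R ((a * b) * c) = mulLeft R (a * c) * mulLeft R b + mulLeft R (b * c) * mulLeft R a
      + mulLeft R (a * b) * mulLeft R c - mulLeft R a * mulLeft R c * mulLeft R b
      - mulLeft R b * mulLeft R c * mulLeft R a := by
  ext v
  have h := linearized_jordan b v a c
  simp only [LinearMap.sub_apply, LinearMap.add_apply, Module.End.mul_apply, mulLeft_apply]
  rw [mul_comm v ((a * b) * c), mul_comm (b * v) c, mul_comm (v * a) c, mul_comm v c,
    mul_comm (b * v), mul_comm (v * a), mul_comm v a] at h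
  rw [eq_sub_iff_add_eq, eq_sub_iff_add_eq, h]
  abel

theorem mulLeft_eq_of_isIdempotentElem {e : A} (he : IsIdempotentElem e) :
    mulLeft R e = 3 • mulLeft R e ^ 2 - 2 • mulLeft R e ^ 3 := by
  have h := mulLeft_mul_mul (R := R) e e e
  rw [he.eq, he.eq] at h
  nth_rewrite 1 [h]
  noncomm_ring

theorem eigenvalue_mulLeft_of_isIdempotentElem [IsDomain R] [Module.IsTorsionFree R A] {e : A}
    (he : IsIdempotentElem e) {μ : R} (hμ : Module.End.HasEigenvalue (mulLeft R e) μ) :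
    μ = 0 ∨ 2 * μ = 1 ∨ μ = 1 := by
  obtain ⟨v, hv⟩ := hμ.exists_hasEigenvector
  have h : (μ - (3 * μ ^ 2 - 2 * μ ^ 3)) • v = 0 := by
    have hv' := LinearMap.congr_fun (mulLeft_eq_of_isIdempotentElem (R := R) he) v
    simp only [LinearMap.sub_apply, LinearMap.smul_apply, hv.pow_apply, hv.apply_eq_smul] at hv'
    rw [sub_smul, hv']
    module
  have h' : μ * (2 * μ - 1) * (μ - 1) = 0 := by
    linear_combination (smul_eq_zero.mp h).resolve_right hv.2
  rcases mul_eq_zero.mp h' with h' | h'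
  · exact (mul_eq_zero.mp h').imp_right fun h' => .inl (sub_eq_zero.mp h')
  · exact .inr (.inr (sub_eq_zero.mp h'))

end NonUnital

section PowerAssociative

variable {R A : Type*} [CommRing R] [NonAssocCommRing A] [IsCommJordan A] [IsAddTorsionFree A]
  [Module R A] [SMulCommClass R A A]

theorem commute_mulLeft_polyEval_X_pow (x : A) (n : ℕ) :
    Commute (mulLeft R (polyEval R x (X ^ n))) (mulLeft R x) := by
  induction n using Nat.twoStepInduction with
  | zero =>
    have h : mulLeft R (polyEval R x (X ^ 0)) = 1 := by ext; simp [polyEval_apply]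
    exact h ▸ Commute.one_left _
  | one => rw [pow_one, polyEval_X]
  | more n hn hn' =>
    have hx := Commute.refl (mulLeft R x)
    have hsq : Commute (mulLeft R (x * x)) (mulLeft R x) :=
      LinearMap.ext (IsJordan.lmul_lmul_comm_lmul x)
    rw [polyEval_X_pow_succ, mul_comm x] at hn'
    rw [polyEval_X_pow_succ, polyEval_X_pow_succ, mul_comm x, mul_comm x, mulLeft_mul_mul]
    exact ((((hn'.mul_left hx).add_left (hsq.mul_left hn)).add_left (hn'.mul_left hx)).sub_left
      ((hn.mul_left hx).mul_left hx)).sub_left ((hx.mul_left hx).mul_left hn)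

variable [IsScalarTower R A A]

theorem commute_mulLeft_polyEval (x : A) (p : R[X]) :
    Commute (mulLeft R (polyEval R x p)) (mulLeft R x) := by
  induction p using Polynomial.induction_on' with
  | add p q hp hq =>
    have h : mulLeft R (polyEval R x (p + q)) = mulLeft R (polyEval R x p) +
        mulLeft R (polyEval R x q) := by ext; simp [add_mul]
    exact h ▸ hp.add_left hq
  | monomial n r =>
    have h : mulLeft R (polyEval R x (monomial n r)) = r • mulLeft R (polyEval R x (X ^ n)) := by
      ext; simp [← smul_X_eq_monomial, smul_mul_assoc]
    exact h ▸ (commute_mulLeft_polyEval_X_pow x n).smul_left r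

theorem polyEval_mul (x : A) (p q : R[X]) :
    polyEval R x (p * q) = polyEval R x p * polyEval R x q := by
  have h : Commute (mulLeft R (polyEval R x p)) (aeval (mulLeft R x) q) :=
    Algebra.commute_of_mem_adjoin_singleton_of_commute (R := R)
      (aeval_mem_adjoin_singleton R (mulLeft R x)) (commute_mulLeft_polyEval x p)
  calc polyEval R x (p * q) = aeval (mulLeft R x) q (mulLeft R (polyEval R x p) 1) := by
        simp [mul_comm p q, polyEval_apply]
    _ = mulLeft R (polyEval R x p) (aeval (mulLeft R x) q 1) := (LinearMap.congr_fun h.eq 1).symm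

end PowerAssociative

end JordanAlgebra

namespace EuclideanJordanAlgebra

open JordanAlgebra Module.End

variable {V : Type*} [NormedAddCommGroup V] [InnerProductSpace ℝ V] [FiniteDimensional ℝ V]
  [EuclideanJordanAlgebra V]

/-- The commutative nonassociative ring underlying a Euclidean Jordan algebra. It is only a local
instance, so that elsewhere the additive structure of `V` stays the one of the normed space. -/
abbrev toNonAssocCommRing : NonAssocCommRing V where
  __ := (inferInstance : AddCommGroup V)
  __ := (inferInstance : CommMagma V)
  left_distrib x y z := by
    rw [mul_comm x, add_mul', mul_comm y, mul_comm z]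
  right_distrib := add_mul'
  zero_mul x := by simpa only [zero_smul] using smul_mul' (0 : ℝ) (0 : V) x
  mul_zero x := by simpa only [zero_smul, mul_comm] using smul_mul' (0 : ℝ) (0 : V) x
  one_mul := one_mul'
  mul_one x := by rw [mul_comm, one_mul']

attribute [local instance] toNonAssocCommRing

theorem isScalarTower : IsScalarTower ℝ V V := ⟨smul_mul'⟩

theorem smulCommClass : SMulCommClass ℝ V V :=
  ⟨fun r x y => by rw [smul_eq_mul, smul_eq_mul, mul_comm x (r • y), smul_mul', mul_comm]⟩

theorem isAddTorsionFree : IsAddTorsionFree V := .of_isTorsionFree ℝ V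

attribute [local instance] isScalarTower smulCommClass isAddTorsionFree

theorem isSymmetric_mulLeft (a : V) : (mulLeft ℝ a).IsSymmetric := inner_mul' a

theorem inner_mul_self_right (a b : V) : inner ℝ a (b * b) = inner ℝ (a * b) b := by
  rw [mul_comm a, inner_mul']

theorem inner_eq_zero_of_mul_eq_zero {a b : V} (h : a * b = 0) : inner ℝ a b = 0 := by
  rw [← mul_one a, inner_mul', h, inner_zero_right]

theorem isPositive_mulLeft_of_isIdempotentElem {e : V} (he : IsIdempotentElem e) :
    (mulLeft ℝ e).IsPositive := by
  refine isPositive_of_forall_eigenvalue_nonneg (isSymmetric_mulLeft e) fun μ hμ => ?_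
  obtain h | h | h : μ = 0 ∨ 2 * μ = 1 ∨ μ = 1 := eigenvalue_mulLeft_of_isIdempotentElem he hμ
  all_goals linarith

/-- The functional calculus of an element `x`, for real functions on the eigenvalues of the
multiplication by `x`, through polynomial interpolation. -/
def functionalCalculus (x : V) : (Eigenvalues (mulLeft ℝ x) → ℝ) →ₗ[ℝ] V :=
  polyEval ℝ x ∘ₗ Lagrange.interpolate Finset.univ (Eigenvalues.val _)

theorem eval_interpolate_eigenvalues (x : V) (f : Eigenvalues (mulLeft ℝ x) → ℝ)
    (μ : Eigenvalues (mulLeft ℝ x)) :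
    (Lagrange.interpolate Finset.univ (Eigenvalues.val _) f).eval (Eigenvalues.val _ μ) = f μ :=
  Lagrange.eval_interpolate_at_node _ Subtype.val_injective.injOn (Finset.mem_univ μ)

theorem functionalCalculus_eq_polyEval {x : V} {f : Eigenvalues (mulLeft ℝ x) → ℝ} {p : ℝ[X]}
    (h : ∀ μ, p.eval (Eigenvalues.val _ μ) = f μ) :
    functionalCalculus x f = polyEval ℝ x p := by
  refine LinearMap.congr_fun
    (aeval_eq_aeval_of_isSymmetric (isSymmetric_mulLeft x) fun μ hμ => ?_) 1
  exact (eval_interpolate_eigenvalues x f ⟨μ, hμ⟩).trans (h ⟨μ, hμ⟩).symm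

theorem functionalCalculus_val (x : V) : functionalCalculus x (Eigenvalues.val _) = x := by
  rw [functionalCalculus_eq_polyEval (p := X) fun _ => eval_X, polyEval_X]

theorem functionalCalculus_mul (x : V) (f g : Eigenvalues (mulLeft ℝ x) → ℝ) :
    functionalCalculus x (f * g) = functionalCalculus x f * functionalCalculus x g := by
  refine (functionalCalculus_eq_polyEval fun μ => ?_).trans (polyEval_mul x _ _)
  rw [eval_mul, eval_interpolate_eigenvalues, eval_interpolate_eigenvalues, Pi.mul_apply]

theorem functionalCalculus_mem_symmetricCone {x : V} {f : Eigenvalues (mulLeft ℝ x) → ℝ}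
    (hf : 0 ≤ f) : functionalCalculus x f ∈ symmetricCone V := by
  refine ⟨functionalCalculus x fun μ => √(f μ), ?_⟩
  rw [← functionalCalculus_mul]
  congr 1 with μ
  exact (Real.mul_self_sqrt (hf μ)).symm

theorem isPositive_mulLeft_functionalCalculus {x : V} {f : Eigenvalues (mulLeft ℝ x) → ℝ}
    (hf : 0 ≤ f) : (mulLeft ℝ (functionalCalculus x f)).IsPositive := by
  classical
  let e (μ : Eigenvalues (mulLeft ℝ x)) : V := functionalCalculus x (Pi.single μ 1)
  have he (μ) : IsIdempotentElem (e μ) := by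
    rw [IsIdempotentElem, ← functionalCalculus_mul, ← Pi.single_mul, one_mul]
  have hsum : mulLeft ℝ (functionalCalculus x f) = ∑ μ, f μ • mulLeft ℝ (e μ) := by
    ext v
    conv_lhs => rw [pi_eq_sum_univ' f]
    simp [e, Finset.sum_mul, smul_mul_assoc]
  rw [hsum]
  exact isPositive_sum _ fun μ _ =>
    (isPositive_mulLeft_of_isIdempotentElem (he μ)).smul_of_nonneg (hf μ)

theorem mem_symmetricCone_iff_isPositive_mulLeft {a : V} :
    a ∈ symmetricCone V ↔ (mulLeft ℝ a).IsPositive := by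
  constructor
  · rintro ⟨x, rfl⟩
    rw [← functionalCalculus_val x, ← functionalCalculus_mul]
    exact isPositive_mulLeft_functionalCalculus fun μ => mul_self_nonneg _
  · intro ha
    rw [← functionalCalculus_val a]
    exact functionalCalculus_mem_symmetricCone fun μ =>
      eigenvalue_nonneg_of_nonneg μ.2 ha.inner_nonneg_right

theorem add_mem_symmetricCone {a b : V} (ha : a ∈ symmetricCone V) (hb : b ∈ symmetricCone V) :
    a + b ∈ symmetricCone V := by
  rw [mem_symmetricCone_iff_isPositive_mulLeft] at ha hb ⊢
  exact (show mulLeft ℝ (a + b) = mulLeft ℝ a + mulLeft ℝ b from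
    LinearMap.ext (add_mul a b)) ▸ ha.add hb

theorem inner_nonneg_of_mem_symmetricCone {a b : V} (ha : a ∈ symmetricCone V)
    (hb : b ∈ symmetricCone V) : 0 ≤ inner ℝ a b := by
  obtain ⟨x, rfl⟩ := hb
  rw [inner_mul_self_right]
  exact (mem_symmetricCone_iff_isPositive_mulLeft.mp ha).inner_nonneg_left x

theorem eq_of_sub_mul_eq_zero {a b : V} (ha : a ∈ symmetricCone V) (hb : b ∈ symmetricCone V)
    {α β : ℝ} (hα : 0 < α) (hβ : 0 < β) (h : (a - b) * (α • a + β • b) = 0) : a = b := by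
  rw [mem_symmetricCone_iff_isPositive_mulLeft] at ha hb
  have hsum : α * inner ℝ (a * (a - b)) (a - b) + β * inner ℝ (b * (a - b)) (a - b) = 0 := by
    rw [← real_inner_smul_left, ← real_inner_smul_left, ← inner_add_left, ← smul_mul_assoc,
      ← smul_mul_assoc, ← add_mul, mul_comm, h, inner_zero_left]
  have ha₀ := mul_nonneg hα.le (ha.inner_nonneg_left (a - b))
  have hb₀ := mul_nonneg hβ.le (hb.inner_nonneg_left (a - b))
  obtain ⟨ha₁, hb₁⟩ := (add_eq_zero_iff_of_nonneg ha₀ hb₀).mp hsum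
  have ha₂ : a * (a - b) = 0 :=
    apply_eq_zero_of_isPositive ha ((mul_eq_zero.mp ha₁).resolve_left hα.ne')
  have hb₂ : b * (a - b) = 0 :=
    apply_eq_zero_of_isPositive hb ((mul_eq_zero.mp hb₁).resolve_left hβ.ne')
  have hsq : (a - b) * (a - b) = 0 := by rw [sub_mul, ha₂, hb₂, sub_zero]
  have hnorm : inner ℝ (a - b) (a - b) = 0 := inner_eq_zero_of_mul_eq_zero hsq
  exact sub_eq_zero.mp (inner_self_eq_zero.mp hnorm)

theorem eq_of_mul_self_eq {a b : V} (ha : a ∈ symmetricCone V) (hb : b ∈ symmetricCone V)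
    (h : a * a = b * b) : a = b := by
  refine eq_of_sub_mul_eq_zero ha hb one_pos one_pos ?_
  rw [one_smul, one_smul, sub_mul, mul_add, mul_add, h, mul_comm b a]
  abel

theorem sqrt_eq {a s : V} (h : IsConeSqrt a s) : sqrt a = s := by
  have hspec : IsConeSqrt a (sqrt a) := Classical.epsilon_spec ⟨s, h⟩
  exact eq_of_mul_self_eq hspec.1 h.1 (hspec.2.trans h.2.symm)

theorem isConeSqrt_functionalCalculus_abs (x : V) :
    IsConeSqrt (x * x) (functionalCalculus x |Eigenvalues.val (mulLeft ℝ x)|) := by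
  refine ⟨functionalCalculus_mem_symmetricCone (abs_nonneg _), ?_⟩
  let c := Eigenvalues.val (mulLeft ℝ x)
  have habs : |c| * |c| = c * c := funext fun μ => abs_mul_abs_self (c μ)
  rw [← functionalCalculus_mul, habs, functionalCalculus_mul, functionalCalculus_val]

theorem isConeSqrt_sqrt {a : V} (ha : a ∈ symmetricCone V) : IsConeSqrt a (sqrt a) := by
  obtain ⟨x, rfl⟩ := ha
  exact Classical.epsilon_spec ⟨_, isConeSqrt_functionalCalculus_abs x⟩

theorem isConeProj_sub_iff {p q z : V} (hp : p ∈ symmetricCone V) (hq : q ∈ symmetricCone V)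
    (hpq : p * q = 0) : IsConeProj (p - q) z ↔ z = p := by
  have hnorm (w : V) : ‖p - q - w‖ ^ 2 = ‖p - q - p‖ ^ 2 + ‖w - p‖ ^ 2 + 2 * inner ℝ w q := by
    rw [show p - q - p = -q by abel, show p - q - w = -(w - p + q) by abel, norm_neg, norm_neg,
      norm_add_sq_real, inner_sub_left, inner_eq_zero_of_mul_eq_zero hpq]
    ring
  constructor
  · rintro ⟨hz, hmin⟩
    have hle := pow_le_pow_left₀ (norm_nonneg _) (hmin p hp) 2
    have hzq := inner_nonneg_of_mem_symmetricCone hz hq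
    have hzero : ‖z - p‖ ^ 2 = 0 := le_antisymm (by linarith [hnorm z]) (sq_nonneg _)
    exact sub_eq_zero.mp (norm_eq_zero.mp (pow_eq_zero_iff two_ne_zero |>.mp hzero))
  · rintro rfl
    refine ⟨hp, fun w hw => le_of_sq_le_sq ?_ (norm_nonneg _)⟩
    linarith [hnorm w, sq_nonneg ‖w - z‖, inner_nonneg_of_mem_symmetricCone hw hq]

theorem posPart_eq_functionalCalculus (x : V) :
    posPart x = functionalCalculus x (Eigenvalues.val (mulLeft ℝ x))⁺ := by
  let c := Eigenvalues.val (mulLeft ℝ x)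
  have hx : functionalCalculus x c⁺ - functionalCalculus x c⁻ = x := by
    rw [← map_sub, posPart_sub_negPart, functionalCalculus_val]
  have hmul : functionalCalculus x c⁺ * functionalCalculus x c⁻ = 0 := by
    have h : c⁺ * c⁻ = 0 := by
      ext μ
      simpa [posPart_eq_zero, negPart_eq_zero] using le_total (c μ) 0
    rw [← functionalCalculus_mul, h, map_zero]
  have hiff (z : V) := isConeProj_sub_iff (z := z)
    (functionalCalculus_mem_symmetricCone (posPart_nonneg c))
    (functionalCalculus_mem_symmetricCone (negPart_nonneg c)) hmul
  rw [hx] at hiff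
  exact (hiff _).mp (Classical.epsilon_spec ⟨_, (hiff _).mpr rfl⟩)

theorem two_smul_posPart (x : V) : (2 : ℝ) • posPart x = x + sqrt (x * x) := by
  rw [posPart_eq_functionalCalculus, sqrt_eq (isConeSqrt_functionalCalculus_abs x), ← map_smul,
    ofNat_smul_eq_nsmul, ← add_abs_eq_two_nsmul_posPart, map_add, functionalCalculus_val]

theorem two_smul_minMap (x y : V) :
    (2 : ℝ) • minMap x y = x + y - sqrt ((x - y) * (x - y)) := by
  rw [minMap, smul_sub, two_smul_posPart]
  module

theorem minMap_eq_zero_iff {x y : V} : minMap x y = 0 ↔ x + y = sqrt ((x - y) * (x - y)) := by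
  rw [← smul_eq_zero_iff_right (two_ne_zero (α := ℝ)), two_smul_minMap, sub_eq_zero]

theorem parallelogram_mul_self (x y : V) :
    (2 : ℝ) • (x * x + y * y) = (x + y) * (x + y) + (x - y) * (x - y) := by
  simp only [add_mul, mul_add, sub_mul, mul_sub, mul_comm y x]
  module

theorem fischerBurmeister_eq_zero_of_minMap_eq_zero {x y : V} (h : minMap x y = 0) :
    fischerBurmeister x y = 0 := by
  have hsum : x + y = sqrt ((x - y) * (x - y)) := minMap_eq_zero_iff.mp h
  have hB : IsConeSqrt ((x - y) * (x - y)) (x + y) := hsum ▸ isConeSqrt_sqrt ⟨x - y, rfl⟩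
  have hsq : (2 : ℝ) • (x * x + y * y) = (2 : ℝ) • ((x + y) * (x + y)) := by
    rw [two_smul ℝ ((x + y) * (x + y)), parallelogram_mul_self, hB.2]
  have hA : IsConeSqrt (x * x + y * y) (x + y) :=
    ⟨hB.1, (smul_right_injective V (two_ne_zero (α := ℝ)) hsq).symm⟩
  rw [fischerBurmeister, sqrt_eq hA, sub_self]

theorem eq_of_two_smul_mul_self_eq_of_smul_eq {a b s : V} (ha : a ∈ symmetricCone V)
    (hb : b ∈ symmetricCone V) {t : ℝ} (ht : (t - 1) ^ 2 < 2)
    (hsq : (2 : ℝ) • (a * a) = s * s + b * b) (hs : (1 + t) • s = (2 * t) • a + (1 - t) • b) :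
    a = b := by
  have hab : (2 * (1 + t) ^ 2) • (a * a) =
      ((2 * t) • a + (1 - t) • b) * ((2 * t) • a + (1 - t) • b) + (1 + t) ^ 2 • (b * b) := by
    rw [← hs, smul_mul_smul_comm, ← pow_two, ← smul_add, ← hsq, smul_smul, mul_comm 2]
  refine eq_of_sub_mul_eq_zero ha hb (α := 2 + 4 * t - 2 * t ^ 2) (β := 2 + 2 * t ^ 2)
    (by linarith) (by positivity) ?_
  rw [← sub_eq_zero.mpr hab]
  simp only [add_mul, mul_add, sub_mul, smul_mul_assoc, mul_smul_comm, mul_comm b a]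
  module

theorem minMap_eq_zero_of_smul_add_smul_eq_zero {x y : V} {t : ℝ} (ht : (t - 1) ^ 2 < 2)
    (h : t • fischerBurmeister x y + (1 - t) • minMap x y = 0) : minMap x y = 0 := by
  obtain ⟨hA, hA₂⟩ := isConeSqrt_sqrt (add_mem_symmetricCone ⟨x, rfl⟩ ⟨y, rfl⟩)
  obtain ⟨hB, hB₂⟩ := isConeSqrt_sqrt (a := (x - y) * (x - y)) ⟨x - y, rfl⟩
  have hcomb : (1 + t) • (x + y) =
      (2 * t) • sqrt (x * x + y * y) + (1 - t) • sqrt ((x - y) * (x - y)) := by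
    have h₂ : (2 * t) • fischerBurmeister x y + (1 - t) • (2 : ℝ) • minMap x y = 0 := by
      rw [mul_smul, smul_comm (1 - t), ← smul_add, h, smul_zero]
    rw [two_smul_minMap, fischerBurmeister] at h₂
    rw [← sub_eq_zero, ← h₂]
    module
  have hAB : sqrt (x * x + y * y) = sqrt ((x - y) * (x - y)) :=
    eq_of_two_smul_mul_self_eq_of_smul_eq hA hB ht
      (by rw [hA₂, hB₂, parallelogram_mul_self]) hcomb
  have ht' : 0 < 1 + t := by nlinarith
  refine minMap_eq_zero_iff.mpr (smul_right_injective V ht'.ne' ?_)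
  simp only [hcomb, hAB]
  module

end EuclideanJordanAlgebra

end

theorem proposition2_general {V : Type*} [NormedAddCommGroup V] [InnerProductSpace ℝ V]
    [FiniteDimensional ℝ V] [EuclideanJordanAlgebra V]
    (x y : V) (t : ℝ) (ht : (t - 1) ^ 2 < 2) :
    t • EuclideanJordanAlgebra.fischerBurmeister x y
        + (1 - t) • EuclideanJordanAlgebra.minMap x y = 0 ↔
      EuclideanJordanAlgebra.minMap x y = 0 := by
  refine ⟨EuclideanJordanAlgebra.minMap_eq_zero_of_smul_add_smul_eq_zero ht, fun h => ?_⟩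
  rw [EuclideanJordanAlgebra.fischerBurmeister_eq_zero_of_minMap_eq_zero h, h, smul_zero,
    smul_zero, add_zero]

theorem proposition2 {V : Type*} [NormedAddCommGroup V] [InnerProductSpace ℝ V]
    [FiniteDimensional ℝ V] [EuclideanJordanAlgebra V]
    (x y : V) (t : ℝ) (ht₀ : 0 ≤ t) (ht₁ : t ≤ 1) :
    t • EuclideanJordanAlgebra.fischerBurmeister x y
        + (1 - t) • EuclideanJordanAlgebra.minMap x y = 0 ↔
      EuclideanJordanAlgebra.minMap x y = 0 := by
  exact proposition2_general x y t (by nlinarith)
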